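/- Let $n\ge 2$, $A=\{0,1,\dots,n-1\}$, and let the plaintext $X=X_1X_2\dots$ and the key $Y=Y_1Y_2\dots$ be independent stationary ergodic processes with values in $A$. Let $Z_i=(X_i+Y_i)\bmod n$ be the ciphertext. Write $\log=\log_2$ and $h(X)=\lim_{m\to\infty}-\frac1{m+1}\sum_{u\in A^{m+1}}P(X_1\dots X_{m+1}=u)\log P(X_1\dots X_{m+1}=u)$, and similarly $h(Y)$; these limits exist. For families of sets $\Psi(z)\subseteq A^t$ of possible decipherings, one for each $t$ and each ciphertext word $z\in A^t$, consider the following properties (with $\log 0=-\infty$): (i) for almost all $Z_1Z_2\dots$ there is $n'$ such that $P\bigl(X_1\dots X_t\in\Psi(Z_1\dots Z_t)\mid Z_1\dots Z_t\bigr)>1-\delta$ for all $t>n'$; (ii) for almost all $Z_1Z_2\dots$ there is $n'$ such that for all $t>n'$ every $x\in\Psi(Z_1\dots Z_t)$ has $P(x\mid Z_1\dots Z_t)>0$, and any $x^1,x^2\in\Psi(Z_1\dots Z_t)$ satisfy $\frac1t\bigl|\log P(x^1\mid Z_1\dots Z_t)-\log P(x^2\mid Z_1\dots Z_t)\bigr|<\varepsilon$;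 (iii) for almost all $Z_1Z_2\dots$, $$\liminf_{t\to\infty}\frac1t\log|\Psi(Z_1\dots Z_t)|\ \ge\ h(X)+h(Y)-\log n .$$ Then for all $\varepsilon>0$ and $\delta>0$ there is a family $\Psi$ with properties (i), (ii) and (iii). Moreover, if $0<\delta<1$, then every family $\Psi$ with property (i) has property (iii). The lower bound in (iii) equals $h(X)-r_Y$, where $r_Y=\log n-h(Y)$ is the redundancy of the key. -/

import Mathlib

open MeasureTheory Filter Topology

noncomputable section

namespace RunningKey

variable {Ω : Type*} [MeasurableSpace Ω] {n : ℕ}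

/-- The left shift on one-sided sequences over the alphabet `{0, …, n - 1}`. -/
def shift (a : ℕ → Fin n) : ℕ → Fin n := fun i => a (i + 1)

/-- The whole trajectory `X₁ X₂ …` of a process; `X i` is the letter number `i + 1`. -/
def path (X : ℕ → Ω → Fin n) (ω : Ω) : ℕ → Fin n := fun i => X i ω

/-- The word `X₁ … X_t` formed by the first `t` letters of a process. -/
def word (X : ℕ → Ω → Fin n) (t : ℕ) (ω : Ω) : Fin t → Fin n := fun i => X i ω

/-- `X` is a stationary ergodic process: its letters are random variables, and its law on sequence
space is invariant under the shift and ergodic for it (`Ergodic` contains the invariance). -/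
structure IsStationaryErgodic (P : Measure Ω) (X : ℕ → Ω → Fin n) : Prop where
  measurable : ∀ i, Measurable (X i)
  ergodic : Ergodic (shift (n := n)) (P.map (path X))

/-- The ciphertext `Z_i = (X_i + Y_i) mod n`; addition in `Fin n` is addition modulo `n`. -/
def ciphertext (X Y : ℕ → Ω → Fin n) : ℕ → Ω → Fin n := fun i ω => X i ω + Y i ω

/-- `P_X(u)`, the probability that `X₁ … X_t = u`. -/
def wordProb (P : Measure Ω) (X : ℕ → Ω → Fin n) {t : ℕ} (u : Fin t → Fin n) : ℝ :=
  P.real {ω | word X t ω = u}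

/-- The entropy of order `m`, in bits per letter:
`h_m(X) = - (m + 1)⁻¹ ∑_{u ∈ A^{m+1}} P_X(u) log₂ P_X(u)`, with `0 log₂ 0 = 0`. -/
def orderEntropy (P : Measure Ω) (X : ℕ → Ω → Fin n) (m : ℕ) : ℝ :=
  -(1 / ((m : ℝ) + 1)) *
    ∑ u : Fin (m + 1) → Fin n, wordProb P X u * Real.logb 2 (wordProb P X u)

/-- The limit entropy `h(X) = lim_{m → ∞} h_m(X)`. -/
def entropy (P : Measure Ω) (X : ℕ → Ω → Fin n) : ℝ :=
  limUnder atTop (orderEntropy P X)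

/-- The redundancy `log₂ n - h(X)`. -/
def redundancy (P : Measure Ω) (X : ℕ → Ω → Fin n) : ℝ :=
  Real.logb 2 n - entropy P X

/-- `P(X₁ … X_t ∈ S | Z₁ … Z_t = z)`. -/
def condProb (P : Measure Ω) (X Z : ℕ → Ω → Fin n) {t : ℕ} (z : Fin t → Fin n)
    (S : Finset (Fin t → Fin n)) : ℝ :=
  (ProbabilityTheory.cond P {ω | word Z t ω = z}).real {ω | word X t ω ∈ S}

/-- A choice, for every length `t` and every ciphertext word `z` of length `t`, of a set of
possible decipherings (plaintext words of length `t`). -/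
abbrev DecipheringSets (n : ℕ) : Type :=
  (t : ℕ) → (Fin t → Fin n) → Finset (Fin t → Fin n)

/-- For almost every ciphertext, from some length on, the set `Ψ(Z₁ … Z_t)` has conditional
probability greater than `1 - δ` given `Z₁ … Z_t`. -/
def HasHighProbability (P : Measure Ω) (X Z : ℕ → Ω → Fin n) (δ : ℝ)
    (Ψ : DecipheringSets n) : Prop :=
  ∀ᵐ ω ∂P, ∀ᶠ t : ℕ in atTop,
    1 - δ < condProb P X Z (word Z t ω) (Ψ t (word Z t ω))

/-- For almost every ciphertext, from some length on, all elements of `Ψ(Z₁ … Z_t)` have positive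
conditional probabilities given `Z₁ … Z_t`, and any two of these are `ε`-close on the normalized
logarithmic scale. -/
def IsNearlyEquiprobable (P : Measure Ω) (X Z : ℕ → Ω → Fin n) (ε : ℝ)
    (Ψ : DecipheringSets n) : Prop :=
  ∀ᵐ ω ∂P, ∀ᶠ t : ℕ in atTop,
    (∀ x ∈ Ψ t (word Z t ω), 0 < condProb P X Z (word Z t ω) {x}) ∧
    ∀ x₁ ∈ Ψ t (word Z t ω), ∀ x₂ ∈ Ψ t (word Z t ω),
      1 / (t : ℝ) * |Real.logb 2 (condProb P X Z (word Z t ω) {x₁}) -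
        Real.logb 2 (condProb P X Z (word Z t ω) {x₂})| < ε

/-- `(1 / t) log₂ k` for `k` elements, with the value `-∞` for `k = 0`. -/
def logRate (t k : ℕ) : EReal :=
  if k = 0 then ⊥ else ((1 / (t : ℝ) * Real.logb 2 k : ℝ) : EReal)

/-- For almost every ciphertext, `liminf_{t → ∞} (1 / t) log₂ |Ψ(Z₁ … Z_t)| ≥ r`. -/
def GrowthExponentAtLeast (P : Measure Ω) (Z : ℕ → Ω → Fin n) (r : ℝ)
    (Ψ : DecipheringSets n) : Prop :=
  ∀ᵐ ω ∂P, (r : EReal) ≤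
    liminf (fun t : ℕ => logRate t (Ψ t (word Z t ω)).card) atTop

end RunningKey

end

/-! By independence, the joint probability of plaintext `x` and ciphertext `z` is `P_X(x) P_Y(z -
x)`. The Shannon–McMillan–Breiman theorem, applied to `X` and to `Y`, shows that almost surely the
true pair has joint probability `2^(-t (h(X) + h(Y)))` up to a subexponential factor. Let
`typicalSet` collect, for given `z`, all `x` with joint probability of this size. Conditioning on
`z` divides all of them by the same number, so they are nearly equiprobable. The true plaintext is
eventually typical, and Doob's maximal inequality turns this into high conditional probability given
the ciphertext (`hasHighProbability_typicalSet`).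

For the exponent, Borel–Cantelli gives `P(z) ≥ 2^(-t (log n + ε))` eventually, as there are only
`n^t` words. A set of conditional probability above `1 - δ` shares conditional probability at least
`(1 - δ) / 2` with the typical set, whose elements have joint probability at most `2^(-t (h(X) +
h(Y) - ε))`; this bounds its cardinality from below (`mul_exp_le_card`).

Shannon–McMillan–Breiman is proved by tilings. If almost every point starts with a block of
probability above `exp (K - c l)` for every `K`, then a long word is covered by such blocks and few
single letters, so a mixture of tilings gives it weight about `exp (-c N)`. A Borel–Cantelli
comparison with this subprobability bounds the true probability from below
(`ae_eventually_exp_le_cylProb`). A zero-one law for the upper bound does the rest. -/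

namespace RunningKey

/-! ### Borel–Cantelli and Doob bounds for finite-valued observations -/

section FiniteValued

variable {Ω : Type*} [MeasurableSpace Ω] {P : Measure Ω} [IsProbabilityMeasure P]

theorem measureReal_eq_sum_fiber {V : Type*} [Fintype V] [MeasurableSpace V]
    [MeasurableSingletonClass V] {W : Ω → V} (hW : Measurable W) (C : Set Ω) :
    P.real C = ∑ v, P.real (C ∩ {ω | W ω = v}) := by
  have h := sum_measureReal_preimage_singleton (μ := P.restrict C) Finset.univ (f := W)
    (fun v _ => hW (measurableSet_singleton v))
  simp only [Finset.coe_univ, Set.preimage_univ] at h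
  rw [show (P.restrict C).real Set.univ = P.real C by simp [measureReal_def]] at h
  rw [← h]
  refine Finset.sum_congr rfl fun v _ => ?_
  rw [measureReal_restrict_apply (hW (measurableSet_singleton v)), Set.inter_comm]
  rfl

/-- A Markov inequality: it is unlikely to see a value whose probability lies below `g`. -/
theorem measureReal_prob_lt_le_sum {V : Type*} [Fintype V] [MeasurableSpace V]
    [MeasurableSingletonClass V] {W : Ω → V} (hW : Measurable W) {g : V → ℝ} (hg : ∀ v, 0 ≤ g v) :
    P.real {ω | P.real {ω' | W ω' = W ω} < g (W ω)} ≤ ∑ v, g v := by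
  rw [measureReal_eq_sum_fiber hW]
  refine Finset.sum_le_sum fun v _ => ?_
  by_cases h : P.real {ω' | W ω' = v} < g v
  · exact (measureReal_mono Set.inter_subset_right).trans h.le
  · have : {ω | P.real {ω' | W ω' = W ω} < g (W ω)} ∩ {ω | W ω = v} = ∅ := by
      ext ω
      simp only [Set.mem_inter_iff, Set.mem_ofPred_eq, Set.mem_empty_iff_false, iff_false]
      rintro ⟨h1, rfl⟩
      exact h h1
    rw [this]
    simpa using hg v

variable {V : ℕ → Type*} [∀ t, Fintype (V t)] [∀ t, MeasurableSpace (V t)]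
  [∀ t, MeasurableSingletonClass (V t)] {W : ∀ t, Ω → V t}

/-- Borel–Cantelli: by the Markov inequality above, the bound fails at time `t` with probability at
most `exp (-ε t)`. It compares the true law with an arbitrary subprobability `g t`. -/
theorem ae_eventually_exp_mul_le_prob (hW : ∀ t, Measurable (W t)) {g : ∀ t, V t → ℝ}
    (hg : ∀ t v, 0 ≤ g t v) (hg1 : ∀ t, ∑ v, g t v ≤ 1) {ε : ℝ} (hε : 0 < ε) :
    ∀ᵐ ω ∂P, ∀ᶠ t : ℕ in atTop,
      Real.exp (-ε * t) * g t (W t ω) ≤ P.real {ω' | W t ω' = W t ω} := by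
  have hle : ∀ t : ℕ, P {ω | P.real {ω' | W t ω' = W t ω} < Real.exp (-ε * t) * g t (W t ω)} ≤
      ENNReal.ofReal (Real.exp (-ε) ^ t) := by
    intro t
    rw [← ofReal_measureReal]
    refine ENNReal.ofReal_le_ofReal ?_
    refine (measureReal_prob_lt_le_sum (hW t) (g := fun v => Real.exp (-ε * t) * g t v)
      fun v => mul_nonneg (Real.exp_nonneg _) (hg t v)).trans ?_
    rw [← Finset.mul_sum, ← Real.exp_nat_mul, mul_comm (-ε)]
    exact mul_le_of_le_one_right (Real.exp_nonneg _) (hg1 t)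
  have hs : Summable fun t : ℕ => Real.exp (-ε) ^ t :=
    summable_geometric_of_lt_one (Real.exp_nonneg _) (by simpa using hε)
  have hfin := ne_top_of_le_ne_top hs.tsum_ofReal_ne_top (ENNReal.tsum_le_tsum hle)
  filter_upwards [ae_eventually_notMem hfin] with ω hω
  filter_upwards [hω] with t ht
  simpa using ht

/-- Doob's maximal inequality for the conditional probabilities of an event `B` given the finer and
finer observations `W t`. -/
theorem mul_measure_exists_lt_le (hW : ∀ t, Measurable (W t))
    (hmono : ∀ s t ω ω', s ≤ t → W t ω = W t ω' → W s ω = W s ω')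
    {B : Set Ω} {δ : ℝ} (hδ : 0 ≤ δ) :
    ENNReal.ofReal δ * P {ω | ∃ t, δ * P.real {ω' | W t ω' = W t ω} <
      P.real (B ∩ {ω' | W t ω' = W t ω})} ≤ P B := by
  set q : ℕ → Ω → Prop := fun t ω => δ * P.real {ω' | W t ω' = W t ω} <
      P.real (B ∩ {ω' | W t ω' = W t ω}) with hq
  -- `C t` is the event that the threshold is first crossed at time `t`. It is a union of fibres of
  -- `W t`, and on each of these `B` has conditional probability above `δ`; the `C t` are disjoint,
  -- so summing loses nothing.
  set C : ℕ → Set Ω := fun t => {ω | q t ω ∧ ∀ s < t, ¬ q s ω} with hC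
  have hqW : ∀ s t ω ω', s ≤ t → W t ω = W t ω' → (q s ω ↔ q s ω') := by
    intro s t ω ω' hst h
    simp only [hq, hmono s t ω ω' hst h]
  have hCW : ∀ t ω ω', W t ω = W t ω' → (ω ∈ C t ↔ ω' ∈ C t) := by
    intro t ω ω' h
    simp only [hC, Set.mem_ofPred_eq, hqW t t ω ω' le_rfl h]
    refine and_congr_right fun _ => forall₂_congr fun s hs => ?_
    rw [hqW s t ω ω' hs.le h]
  have hCm : ∀ t, MeasurableSet (C t) := by
    intro t
    have : C t = W t ⁻¹' (W t '' C t) := by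
      refine (Set.subset_preimage_image _ _).antisymm ?_
      rintro ω ⟨ω', h1, h2⟩
      exact (hCW t ω' ω h2).1 h1
    rw [this]
    exact hW t (Set.toFinite _).measurableSet
  have hunion : {ω | ∃ t, q t ω} = ⋃ t, C t := by
    classical
    ext ω
    simp only [Set.mem_ofPred_eq, Set.mem_iUnion, hC]
    constructor
    · intro h
      exact ⟨Nat.find h, Nat.find_spec h, fun s hs => Nat.find_min h hs⟩
    · rintro ⟨t, h, -⟩
      exact ⟨t, h⟩
  have hdisj : Pairwise (Function.onFun Disjoint C) := by
    intro s t hst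
    refine Set.disjoint_left.2 ?_
    rintro ω ⟨h1, h2⟩ ⟨h3, h4⟩
    rcases lt_or_gt_of_ne hst with h | h
    · exact h4 s h h1
    · exact h2 t h h3
  have hstep : ∀ t, ENNReal.ofReal δ * P (C t) ≤ P (B ∩ C t) := by
    intro t
    rw [← ofReal_measureReal, ← ofReal_measureReal (s := B ∩ C t), ← ENNReal.ofReal_mul hδ]
    refine ENNReal.ofReal_le_ofReal ?_
    rw [measureReal_eq_sum_fiber (hW t) (C t), measureReal_eq_sum_fiber (hW t) (B ∩ C t),
      Finset.mul_sum]
    refine Finset.sum_le_sum fun v _ => ?_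
    by_cases hv : ∃ ω ∈ C t, W t ω = v
    · obtain ⟨ω, hω, rfl⟩ := hv
      have hsub : {ω' | W t ω' = W t ω} ⊆ C t := fun ω' h => (hCW t ω' ω h).2 hω
      rw [Set.inter_assoc, Set.inter_eq_self_of_subset_right hsub]
      exact hω.1.le
    · have : C t ∩ {ω | W t ω = v} = ∅ := by
        ext ω
        simp only [Set.mem_inter_iff, Set.mem_ofPred_eq, Set.mem_empty_iff_false, iff_false]
        exact fun h => hv ⟨ω, h.1, h.2⟩
      rw [this]
      simp
  rw [hunion, measure_iUnion hdisj hCm, ← ENNReal.tsum_mul_left]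
  calc ∑' t, ENNReal.ofReal δ * P (C t) ≤ ∑' t, P (B ∩ C t) := ENNReal.tsum_le_tsum hstep
    _ = ∑' t, (P.restrict B) (C t) := by
        refine tsum_congr fun t => ?_
        rw [Measure.restrict_apply (hCm t), Set.inter_comm]
    _ = (P.restrict B) (⋃ t, C t) := (measure_iUnion hdisj hCm).symm
    _ ≤ (P.restrict B) Set.univ := measure_mono (Set.subset_univ _)
    _ = P B := by simp

/-- If almost surely the events `G t` occur from some time on, then almost surely the conditional
probabilities of their complements given the observations `W t` tend to zero. -/
theorem ae_eventually_condProb_compl_le (hW : ∀ t, Measurable (W t))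
    (hmono : ∀ s t ω ω', s ≤ t → W t ω = W t ω' → W s ω = W s ω')
    {G : ℕ → Set Ω} (hGm : ∀ t, MeasurableSet (G t)) (hG : ∀ᵐ ω ∂P, ∀ᶠ t in atTop, ω ∈ G t)
    {δ : ℝ} (hδ : 0 < δ) :
    ∀ᵐ ω ∂P, ∀ᶠ t in atTop,
      P.real ((G t)ᶜ ∩ {ω' | W t ω' = W t ω}) ≤ δ * P.real {ω' | W t ω' = W t ω} := by
  -- Doob's inequality needs an event that does not vary with `t`: `B N` contains all `(G t)ᶜ` with
  -- `t ≥ N`, and its probability tends to zero.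
  set B : ℕ → Set Ω := fun N => ⋃ t ≥ N, (G t)ᶜ with hB
  have hBanti : Antitone B := by
    intro M N hMN
    exact Set.biUnion_subset_biUnion_left fun t (ht : t ≥ N) => le_trans hMN ht
  have hBlim : Tendsto (fun N => P (B N)) atTop (𝓝 0) := by
    have h0 : P (⋂ N, B N) = 0 := by
      refine measure_mono_null ?_ (ae_iff.1 hG)
      intro ω hω
      simp only [hB, Set.mem_iInter, Set.mem_iUnion] at hω
      simp only [Set.mem_ofPred_eq, eventually_atTop, not_exists, not_forall]
      intro N
      obtain ⟨t, ht, h⟩ := hω N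
      exact ⟨t, ht, h⟩
    rw [← h0]
    refine tendsto_measure_iInter_atTop (fun N => ?_) hBanti ⟨0, measure_ne_top _ _⟩
    exact (MeasurableSet.biUnion (Set.to_countable _) fun t _ => (hGm t).compl).nullMeasurableSet
  rw [ae_iff]
  set F := {ω | ¬ ∀ᶠ t in atTop,
      P.real ((G t)ᶜ ∩ {ω' | W t ω' = W t ω}) ≤ δ * P.real {ω' | W t ω' = W t ω}}
  have hF : ∀ N, ENNReal.ofReal δ * P F ≤ P (B N) := by
    intro N
    refine le_trans ?_ (mul_measure_exists_lt_le hW hmono (B := B N) hδ.le)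
    gcongr
    intro ω hω
    have hω' : ∃ᶠ t in atTop, ¬ P.real ((G t)ᶜ ∩ {ω' | W t ω' = W t ω}) ≤
      δ * P.real {ω' | W t ω' = W t ω} :=
      not_eventually.1 hω
    obtain ⟨t, h, ht⟩ := (hω'.and_eventually (eventually_ge_atTop N)).exists
    refine ⟨t, (not_le.1 h).trans_le (measureReal_mono ?_)⟩
    exact Set.inter_subset_inter_left _ (Set.subset_biUnion_of_mem (u := fun t => (G t)ᶜ) ht)
  have h0 : ENNReal.ofReal δ * P F = 0 := le_antisymm (ge_of_tendsto' hBlim hF) bot_le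
  simpa [hδ.not_ge] using h0

end FiniteValued

/-! ### The maximal ergodic theorem -/

section Ergodic

variable {S : Type*} {T : S → S} {f : S → ℝ}

/-- The maximum of the Birkhoff sums of `f` of length at most `N`, the empty one included. -/
noncomputable def maxBirkhoffSum (T : S → S) (f : S → ℝ) : ℕ → S → ℝ
  | 0, _ => 0
  | N + 1, x => max 0 (f x + maxBirkhoffSum T f N (T x))

theorem maxBirkhoffSum_nonneg (N : ℕ) (x : S) : 0 ≤ maxBirkhoffSum T f N x := by
  cases N with
  | zero => exact le_rfl
  | succ N => exact le_max_left _ _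

theorem maxBirkhoffSum_le_succ (N : ℕ) (x : S) :
    maxBirkhoffSum T f N x ≤ maxBirkhoffSum T f (N + 1) x := by
  induction N generalizing x with
  | zero => exact maxBirkhoffSum_nonneg _ _
  | succ N ih => exact max_le_max_left _ (add_le_add_right (ih _) _)

theorem birkhoffSum_le_maxBirkhoffSum (N : ℕ) (x : S) :
    birkhoffSum T f N x ≤ maxBirkhoffSum T f N x := by
  induction N generalizing x with
  | zero => simp [maxBirkhoffSum]
  | succ N ih =>
    rw [birkhoffSum_succ']
    exact (add_le_add_right (ih _) _).trans (le_max_right _ _)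

variable [MeasurableSpace S] {μ : Measure S}

theorem integrable_maxBirkhoffSum (hT : MeasurePreserving T μ μ) (hf : Integrable f μ) (N : ℕ) :
    Integrable (maxBirkhoffSum T f N) μ := by
  induction N with
  | zero => exact integrable_zero _ _ _
  | succ N ih =>
    exact (integrable_zero S ℝ μ).sup (hf.add (hT.integrable_comp_of_integrable ih))

/-- Garsia's argument: `M ≤ 1_{M > 0} f + M ∘ T` pointwise, and by invariance the integrals of `M`
and `M ∘ T` cancel. -/
theorem setIntegral_maxBirkhoffSum_pos_nonneg (hT : MeasurePreserving T μ μ)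
    (hf : Integrable f μ) (N : ℕ) (hM : Measurable (maxBirkhoffSum T f (N + 1))) :
    0 ≤ ∫ x in {x | 0 < maxBirkhoffSum T f (N + 1) x}, f x ∂μ := by
  set M := maxBirkhoffSum T f (N + 1) with hMdef
  have hE : MeasurableSet {x | 0 < M x} := measurableSet_lt measurable_const hM
  have hint := integrable_maxBirkhoffSum hT hf (N + 1)
  have hintT : Integrable (fun x => M (T x)) μ := hT.integrable_comp_of_integrable hint
  have hle : ∀ x, M x ≤ {x | 0 < M x}.indicator f x + M (T x) := by
    intro x
    by_cases hx : 0 < M x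
    · rw [Set.indicator_of_mem (by exact hx)]
      have h1 : M x = f x + maxBirkhoffSum T f N (T x) := by
        rcases max_choice 0 (f x + maxBirkhoffSum T f N (T x)) with h | h
        · exact absurd h hx.ne'
        · exact h
      rw [h1]
      exact add_le_add_right (maxBirkhoffSum_le_succ N (T x)) _
    · rw [Set.indicator_of_notMem (by exact hx), zero_add]
      exact (not_lt.1 hx).trans (maxBirkhoffSum_nonneg _ _)
  have h2 := integral_mono hint ((hf.indicator hE).add hintT) hle
  have h3 : ∫ x, M (T x) ∂μ = ∫ x, M x ∂μ := by
    rw [← integral_map hT.measurable.aemeasurable (by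
      rw [hT.map_eq]; exact hint.aestronglyMeasurable), hT.map_eq]
  simp only [Pi.add_apply] at h2
  rw [integral_add (hf.indicator hE) hintT, h3, integral_indicator hE] at h2
  linarith

theorem measurable_maxBirkhoffSum (hT : Measurable T) (hf : Measurable f) (N : ℕ) :
    Measurable (maxBirkhoffSum T f N) := by
  induction N with
  | zero => exact measurable_const
  | succ N ih => exact measurable_const.max (hf.add (ih.comp hT))

/-- The maximal ergodic theorem. -/
theorem integral_nonneg_of_ae_exists_birkhoffSum_pos (hT : MeasurePreserving T μ μ)
    (hfm : Measurable f) (hf : Integrable f μ) (h : ∀ᵐ x ∂μ, ∃ N, 0 < birkhoffSum T f N x) :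
    0 ≤ ∫ x, f x ∂μ := by
  set E : ℕ → Set S := fun N => {x | 0 < maxBirkhoffSum T f N x} with hE
  have hEm : ∀ N, MeasurableSet (E N) := fun N =>
    measurableSet_lt measurable_const (measurable_maxBirkhoffSum hT.measurable hfm N)
  have hmono : Monotone E :=
    monotone_nat_of_le_succ fun N x (hx : 0 < _) => hx.trans_le (maxBirkhoffSum_le_succ N x)
  have hlim := tendsto_setIntegral_of_monotone hEm hmono hf.integrableOn
  have huniv : (⋃ N, E N) =ᵐ[μ] Set.univ := by
    refine eventuallyEq_univ.2 ?_
    filter_upwards [h] with x ⟨N, hN⟩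
    exact Set.mem_iUnion.2 ⟨N, hN.trans_le (birkhoffSum_le_maxBirkhoffSum N x)⟩
  rw [setIntegral_congr_set huniv, setIntegral_univ] at hlim
  refine ge_of_tendsto (hlim.comp (tendsto_add_atTop_nat 1)) (.of_forall fun N => ?_)
  exact setIntegral_maxBirkhoffSum_pos_nonneg hT hf N
    (measurable_maxBirkhoffSum hT.measurable hfm _)

/-- For an ergodic map the Birkhoff sums of a function with negative integral are almost everywhere
bounded above. -/
theorem ae_exists_birkhoffSum_le [IsFiniteMeasure μ] (hT : Ergodic T μ) (hfm : Measurable f)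
    (hf : Integrable f μ) (hneg : ∫ x, f x ∂μ < 0) :
    ∀ᵐ x ∂μ, ∃ K : ℕ, ∀ N, birkhoffSum T f N x ≤ K := by
  set F : Set S := {x | ∀ K : ℕ, ∃ N, (K : ℝ) < birkhoffSum T f N x} with hF
  have hSm : ∀ N, Measurable (birkhoffSum T f N) := fun N =>
    Finset.measurable_fun_sum _ fun i _ => hfm.comp (hT.measurable.iterate i)
  have hFm : MeasurableSet F := by
    simp only [hF, Set.ofPred_forall, Set.ofPred_exists]
    exact .iInter fun K => .iUnion fun N => measurableSet_lt measurable_const (hSm N)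
  have hFT : F ⊆ T ⁻¹' F := by
    intro x hx K
    -- The surplus `⌈|f x|⌉₊` pays for the first term of the Birkhoff sum, which the shift drops.
    obtain ⟨N, hN⟩ := hx (K + ⌈|f x|⌉₊)
    have h1 := Nat.le_ceil |f x|
    push_cast at hN
    cases N with
    | zero =>
      rw [birkhoffSum_zero] at hN
      have h2 : (0 : ℝ) ≤ K := K.cast_nonneg
      have h3 := abs_nonneg (f x)
      linarith
    | succ N =>
      rw [birkhoffSum_succ'] at hN
      exact ⟨N, by linarith [le_abs_self (f x)]⟩
  rcases hT.ae_empty_or_univ_of_ae_le_preimage hFm.nullMeasurableSet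
    (LE.le.eventuallyLE hFT) with h | h
  · filter_upwards [eventuallyEq_empty.1 h] with x hx
    simpa [hF] using hx
  · exfalso
    refine hneg.not_ge (integral_nonneg_of_ae_exists_birkhoffSum_pos hT.toMeasurePreserving hfm hf ?_)
    filter_upwards [eventuallyEq_univ.1 h] with x hx
    simpa using hx 0

end Ergodic

/-! ### Cylinder probabilities and sums over words -/

section Words

variable {n : ℕ}

/-- The sequence with first letter `a` that continues as `x`. -/
def scons (a : Fin n) (x : ℕ → Fin n) : ℕ → Fin n
  | 0 => a
  | i + 1 => x i

/-- The measure of the cylinder formed by the first `t` letters of `x`. -/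
noncomputable def cylProb (μ : Measure (ℕ → Fin n)) (t : ℕ) (x : ℕ → Fin n) : ℝ :=
  μ.real {y | ∀ i < t, y i = x i}

/-- The first `t` letters of `x`. -/
def firstLetters (t : ℕ) (x : ℕ → Fin n) : Fin t → Fin n := fun i => x i

theorem measurable_firstLetters (t : ℕ) : Measurable (firstLetters (n := n) t) :=
  measurable_pi_lambda _ fun _ => measurable_pi_apply _

theorem cylinder_eq (t : ℕ) (x : ℕ → Fin n) :
    {y : ℕ → Fin n | ∀ i < t, y i = x i} = {y | firstLetters t y = firstLetters t x} := by
  ext y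
  simp only [Set.mem_ofPred_eq, firstLetters, funext_iff]
  exact ⟨fun h i => h i i.2, fun h i hi => h ⟨i, hi⟩⟩

variable {μ : Measure (ℕ → Fin n)}

theorem cylProb_nonneg (t : ℕ) (x : ℕ → Fin n) : 0 ≤ cylProb μ t x := measureReal_nonneg

theorem dependsOn_cylProb (t : ℕ) : DependsOn (cylProb μ t) (Set.Iio t) := by
  intro x y hxy
  unfold cylProb
  congr 1
  ext z
  exact forall₂_congr fun i hi => by rw [hxy i hi]

theorem cylProb_le_one [IsProbabilityMeasure μ] (t : ℕ) (x : ℕ → Fin n) : cylProb μ t x ≤ 1 := measureReal_le_one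

theorem cylProb_succ_le_shift [IsFiniteMeasure μ]
    (hμ : MeasurePreserving (shift (n := n)) μ μ) (t : ℕ)
    (x : ℕ → Fin n) : cylProb μ (t + 1) x ≤ cylProb μ t (shift x) := by
  have hm : MeasurableSet {y : ℕ → Fin n | ∀ i < t, y i = shift x i} := by
    rw [cylinder_eq]
    exact measurable_firstLetters t (measurableSet_singleton _)
  unfold cylProb
  rw [← hμ.measureReal_preimage hm.nullMeasurableSet]
  exact measureReal_mono fun y hy i hi => hy (i + 1) (Nat.succ_lt_succ hi)

variable [NeZero n]

/-- The sequence that starts with the word `u` and continues with zeros. -/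
def extend {N : ℕ} (u : Fin N → Fin n) : ℕ → Fin n := fun i => if h : i < N then u ⟨i, h⟩ else 0

/-- The sum of `F` over all words of length `N`, extended by zeros. -/
noncomputable def wordSum (N : ℕ) (F : (ℕ → Fin n) → ℝ) : ℝ := ∑ u : Fin N → Fin n, F (extend u)

theorem extend_cons {N : ℕ} (a : Fin n) (u : Fin N → Fin n) :
    extend (Fin.cons a u : Fin (N + 1) → Fin n) = scons a (extend u) := by
  funext i
  cases i with
  | zero => simp [extend, scons]
  | succ i =>
    by_cases h : i < N
    · simp only [extend, scons, h, Nat.succ_lt_succ_iff, dif_pos]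
      exact Fin.cons_succ (α := fun _ => Fin n) a u ⟨i, h⟩
    · simp [extend, scons, h]

theorem wordSum_succ (N : ℕ) (F : (ℕ → Fin n) → ℝ) :
    wordSum (N + 1) F = ∑ a, wordSum N fun x => F (scons a x) := by
  simp only [wordSum]
  rw [← (Fin.consEquiv fun _ => Fin n).sum_comp, Fintype.sum_prod_type]
  refine Finset.sum_congr rfl fun a _ => Finset.sum_congr rfl fun u _ => ?_
  rw [← extend_cons]
  rfl

theorem wordSum_zero (F : (ℕ → Fin n) → ℝ) : wordSum 0 F = F fun _ => 0 := by
  simp only [wordSum, Fintype.sum_unique]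
  rfl

theorem wordSum_add (N : ℕ) (F G : (ℕ → Fin n) → ℝ) :
    wordSum N (fun x => F x + G x) = wordSum N F + wordSum N G :=
  Finset.sum_add_distrib

theorem wordSum_const_mul (N : ℕ) (a : ℝ) (F : (ℕ → Fin n) → ℝ) :
    wordSum N (fun x => a * F x) = a * wordSum N F :=
  (Finset.mul_sum ..).symm

theorem wordSum_sum {ι : Type*} (s : Finset ι) (N : ℕ) (F : ι → (ℕ → Fin n) → ℝ) :
    wordSum N (fun x => ∑ i ∈ s, F i x) = ∑ i ∈ s, wordSum N (F i) :=
  Finset.sum_comm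

/-- A word of length `l + m` is a free concatenation, and `f` sees only the first piece. This
removes the first block of a tiling. -/
theorem wordSum_mul_shift {l : ℕ} (m : ℕ) {f : (ℕ → Fin n) → ℝ}
    (hf : DependsOn f (Set.Iio l)) (g : (ℕ → Fin n) → ℝ) :
    wordSum (l + m) (fun x => f x * g (shift^[l] x)) = wordSum l f * wordSum m g := by
  induction l generalizing f with
  | zero =>
    have h : ∀ x, f x = f fun _ => 0 := fun x => hf fun i hi => absurd hi (Nat.not_lt_zero i)
    simp only [Function.iterate_zero, id, zero_add, wordSum_zero]
    rw [← wordSum_const_mul]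
    congr 1
    funext x
    rw [h x]
  | succ l ih =>
    rw [show l + 1 + m = (l + m) + 1 by omega, wordSum_succ, wordSum_succ, Finset.sum_mul]
    refine Finset.sum_congr rfl fun a _ => ?_
    rw [← ih]
    · rfl
    · intro x y hxy
      refine hf fun i hi => ?_
      cases i with
      | zero => rfl
      | succ i => exact hxy i (Nat.lt_of_succ_lt_succ hi)

theorem firstLetters_extend {t : ℕ} (u : Fin t → Fin n) : firstLetters t (extend u) = u := by
  funext i
  simp [firstLetters, extend]

theorem extend_firstLetters {t : ℕ} (x : ℕ → Fin n) {i : ℕ} (hi : i < t) :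
    extend (firstLetters t x) i = x i := by
  simp [firstLetters, extend, hi]

theorem measurable_cylProb (t : ℕ) : Measurable (cylProb μ t) := by
  have : cylProb μ t = (fun u => cylProb μ t (extend u)) ∘ firstLetters t := by
    funext x
    exact dependsOn_cylProb t fun i hi => (extend_firstLetters x hi).symm
  rw [this]
  exact (measurable_of_finite _).comp (measurable_firstLetters t)

theorem wordSum_cylProb [IsProbabilityMeasure μ] (t : ℕ) : wordSum t (cylProb μ t) = 1 := by
  have h := measureReal_eq_sum_fiber (P := μ) (measurable_firstLetters t) Set.univ
  simp only [Set.univ_inter, probReal_univ] at h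
  rw [h]
  refine Finset.sum_congr rfl fun u _ => ?_
  unfold cylProb
  rw [cylinder_eq, firstLetters_extend]

end Words

/-! ### Weights of tilings of a word by blocks and letters -/

section Tilings

variable {n : ℕ} {p : ℕ → (ℕ → Fin n) → ℝ} {a : ℝ} {b : ℕ → ℝ}

/-- The total weight of the tilings of the first `N` letters of a sequence by single letters, of
weight `a`, and by blocks; a block of length `l` at the start of `x` has weight `b l * p l x`. -/
noncomputable def tileWeight (p : ℕ → (ℕ → Fin n) → ℝ) (a : ℝ) (b : ℕ → ℝ) :
    ℕ → (ℕ → Fin n) → ℝ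
  | 0, _ => 1
  | N + 1, x => a * tileWeight p a b N (shift x) +
      ∑ l : Fin (N + 1), b (l + 1) * (p (l + 1) x * tileWeight p a b (N - l) (shift^[l + 1] x))
  termination_by N => N
  decreasing_by all_goals omega

theorem shift_iterate_apply (l : ℕ) (x : ℕ → Fin n) (i : ℕ) : shift^[l] x i = x (i + l) := by
  induction l generalizing x with
  | zero => rfl
  | succ l ih => rw [Function.iterate_succ_apply, ih]; rfl

theorem dependsOn_tileWeight (hp : ∀ t, DependsOn (p t) (Set.Iio t)) (N : ℕ) :
    DependsOn (tileWeight p a b N) (Set.Iio N) := by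
  induction N using Nat.strong_induction_on with
  | _ N ih =>
    cases N with
    | zero => intro x y _; simp [tileWeight]
    | succ N =>
      intro x y hxy
      rw [tileWeight, tileWeight]
      congr 1
      · congr 1
        exact ih N (Nat.lt_succ_self N) fun i hi => hxy (i + 1) (Nat.succ_lt_succ hi)
      · refine Finset.sum_congr rfl fun l _ => ?_
        have hl := l.2
        rw [hp (l + 1) fun i hi => hxy i (Set.mem_Iio.2 (lt_of_lt_of_le (Set.mem_Iio.1 hi) hl)),
          ih (N - l) (by omega) fun i hi => ?_]
        rw [shift_iterate_apply, shift_iterate_apply]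
        refine hxy _ ?_
        simp only [Set.mem_Iio] at hi ⊢
        omega

theorem tileWeight_nonneg (hp : ∀ t x, 0 ≤ p t x) (ha : 0 ≤ a) (hb : ∀ l, 0 ≤ b l) (N : ℕ)
    (x : ℕ → Fin n) : 0 ≤ tileWeight p a b N x := by
  induction N using Nat.strong_induction_on generalizing x with
  | _ N ih =>
    cases N with
    | zero => simp [tileWeight]
    | succ N =>
      rw [tileWeight]
      refine add_nonneg (mul_nonneg ha (ih N (Nat.lt_succ_self N) _))
        (Finset.sum_nonneg fun l _ => mul_nonneg (hb _) (mul_nonneg (hp _ _) (ih _ ?_ _)))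
      omega

/-- Sum over the first tile: each of the `n` letters contributes `a`, and the blocks of length `l`
contribute `b l` altogether. `hab` bounds this by one, and induction handles the remaining word. -/
theorem wordSum_tileWeight_le_one [NeZero n] (hp : ∀ t, DependsOn (p t) (Set.Iio t))
    (hp1 : ∀ t, wordSum t (p t) = 1) (ha : 0 ≤ a) (hb : ∀ l, 0 ≤ b l)
    (hab : ∀ m, n * a + ∑ l ∈ Finset.range m, b (l + 1) ≤ 1) (N : ℕ) :
    wordSum N (tileWeight p a b N) ≤ 1 := by
  induction N using Nat.strong_induction_on with
  | _ N ih =>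
    cases N with
    | zero => simp [wordSum_zero, tileWeight]
    | succ N =>
      have h1 : wordSum (N + 1) (fun x => tileWeight p a b N (shift x)) =
          n * wordSum N (tileWeight p a b N) := by
        rw [wordSum_succ]
        simp [show ∀ (c : Fin n) x, shift (scons c x) = x from fun _ _ => rfl]
      have h2 : ∀ l : Fin (N + 1), wordSum (N + 1)
          (fun x => p (l + 1) x * tileWeight p a b (N - l) (shift^[l + 1] x)) =
          wordSum (N - l) (tileWeight p a b (N - l)) := by
        intro l
        have h := wordSum_mul_shift (N - l) (hp (l + 1)) (tileWeight p a b (N - l))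
        rw [hp1, one_mul, show (l : ℕ) + 1 + (N - l) = N + 1 by omega] at h
        exact h
      have h3 : wordSum (N + 1) (tileWeight p a b (N + 1)) =
          a * (n * wordSum N (tileWeight p a b N)) +
          ∑ l : Fin (N + 1), b (l + 1) * wordSum (N - l) (tileWeight p a b (N - l)) := by
        rw [← h1, ← wordSum_const_mul]
        simp only [← h2]
        simp only [← wordSum_const_mul]
        rw [← wordSum_sum, ← wordSum_add]
        congr 1
        funext x
        rw [tileWeight]
      rw [h3]
      refine le_trans (add_le_add (b := n * a) (d := ∑ l ∈ Finset.range (N + 1), b (l + 1)) ?_ ?_)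
        (hab (N + 1))
      · rw [← mul_assoc, mul_comm a]
        exact mul_le_of_le_one_right (by positivity) (ih N (Nat.lt_succ_self N))
      · rw [← Fin.sum_univ_eq_sum_range (fun l => b (l + 1))]
        exact Finset.sum_le_sum fun l _ => mul_le_of_le_one_right (hb _) (ih _ (by omega))

/-- Keep only the greedy tiling: a single letter at points of `D`, a favourable block elsewhere.
Letters cost `s` each, blocks cost `c` per unit length. -/
theorem exp_le_tileWeight (hp : ∀ t x, 0 ≤ p t x) (hb : ∀ l, 0 ≤ b l) {s c : ℝ} (hs : 0 ≤ s)
    (hc : 0 ≤ c) {D : Set (ℕ → Fin n)} {L : ℕ}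
    (hD : ∀ x ∉ D, ∃ l, 1 ≤ l ∧ l ≤ L ∧ Real.exp (-(c * l)) ≤ b l * p l x) (N : ℕ)
    (x : ℕ → Fin n) :
    Real.exp (-(c * N + s * (birkhoffSum shift (D.indicator 1) N x + L))) ≤
      tileWeight p (Real.exp (-s)) b N x := by
  have hQ := tileWeight_nonneg (b := b) hp (Real.exp_nonneg (-s)) hb
  have hcnt : ∀ (N : ℕ) (x : ℕ → Fin n), 0 ≤ birkhoffSum shift (D.indicator (1 : (ℕ → Fin n) → ℝ)) N x :=
    fun N x => Finset.sum_nonneg fun i _ => Set.indicator_nonneg (fun _ _ => zero_le_one) _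
  have hletter : ∀ (N : ℕ) (x : ℕ → Fin n), Real.exp (-s) * tileWeight p (Real.exp (-s)) b N (shift x) ≤
      tileWeight p (Real.exp (-s)) b (N + 1) x := by
    intro N x
    rw [tileWeight]
    exact le_add_of_nonneg_right (Finset.sum_nonneg fun l _ =>
      mul_nonneg (hb _) (mul_nonneg (hp _ _) (hQ _ _)))
  have hpow : ∀ (N : ℕ) (x : ℕ → Fin n), Real.exp (-(s * N)) ≤ tileWeight p (Real.exp (-s)) b N x := by
    intro N
    induction N with
    | zero => intro x; simp [tileWeight]
    | succ N ih =>
      intro x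
      refine le_trans ?_ (hletter N x)
      rw [show -(s * ((N + 1 : ℕ) : ℝ)) = -s + -(s * N) by push_cast; ring, Real.exp_add]
      exact mul_le_mul_of_nonneg_left (ih _) (Real.exp_nonneg _)
  induction N using Nat.strong_induction_on generalizing x with
  | _ N ih =>
    -- A favourable block might not fit into the last `L` positions, so these are tiled by letters;
    -- hence the summand `L` in the exponent.
    rcases le_or_gt N L with hNL | hNL
    · refine le_trans (Real.exp_le_exp.2 ?_) (hpow N x)
      have h1 : s * N ≤ s * L := mul_le_mul_of_nonneg_left (Nat.cast_le.2 hNL) hs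
      have h2 := mul_nonneg hs (hcnt N x)
      have h3 : 0 ≤ c * N := by positivity
      linarith
    obtain ⟨N, rfl⟩ : ∃ M, N = M + 1 := ⟨N - 1, by omega⟩
    by_cases hx : x ∈ D
    · refine le_trans ?_ (hletter N x)
      refine le_trans ?_ (mul_le_mul_of_nonneg_left (ih N (Nat.lt_succ_self N) (shift x))
        (Real.exp_nonneg _))
      rw [← Real.exp_add, birkhoffSum_succ', Set.indicator_of_mem hx, Pi.one_apply]
      refine Real.exp_le_exp.2 ?_
      push_cast
      linarith
    · obtain ⟨l, hl1, hlL, hl⟩ := hD x hx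
      obtain ⟨l, rfl⟩ : ∃ k, l = k + 1 := ⟨l - 1, by omega⟩
      have hterm : b (l + 1) * (p (l + 1) x *
          tileWeight p (Real.exp (-s)) b (N - l) (shift^[l + 1] x)) ≤
          tileWeight p (Real.exp (-s)) b (N + 1) x := by
        rw [tileWeight.eq_2]
        refine le_trans ?_ (le_add_of_nonneg_left (mul_nonneg (Real.exp_nonneg _) (hQ _ _)))
        exact Finset.single_le_sum (f := fun l : Fin (N + 1) => b (l + 1) * (p (l + 1) x *
          tileWeight p (Real.exp (-s)) b (N - l) (shift^[(l : ℕ) + 1] x)))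
          (fun k _ => mul_nonneg (hb _) (mul_nonneg (hp _ _) (hQ _ _)))
          (Finset.mem_univ (⟨l, by omega⟩ : Fin (N + 1)))
      refine le_trans ?_ hterm
      rw [← mul_assoc]
      refine le_trans ?_ (mul_le_mul hl (ih (N - l) (by omega) _) (Real.exp_nonneg _)
        (mul_nonneg (hb _) (hp _ _)))
      rw [← Real.exp_add]
      refine Real.exp_le_exp.2 ?_
      have hsplit := birkhoffSum_add (shift (n := n)) (D.indicator (1 : (ℕ → Fin n) → ℝ))
        (l + 1) (N - l) x
      rw [show l + 1 + (N - l) = N + 1 by omega] at hsplit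
      have hcast : ((N - l : ℕ) : ℝ) = N - l := Nat.cast_sub (by omega)
      have h1 := mul_nonneg hs (hcnt (l + 1) x)
      rw [hsplit, hcast]
      push_cast
      linarith

end Tilings

/-! ### The Shannon–McMillan–Breiman theorem -/

section AsymptoticEquipartition

variable {n : ℕ} [NeZero n] {μ : Measure (ℕ → Fin n)} [IsProbabilityMeasure μ]

theorem ae_eventually_exp_mul_le_cylProb {g : ℕ → (ℕ → Fin n) → ℝ} (hg : ∀ t x, 0 ≤ g t x)
    (hgd : ∀ t, DependsOn (g t) (Set.Iio t)) (hg1 : ∀ t, wordSum t (g t) ≤ 1)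
    {ε : ℝ} (hε : 0 < ε) :
    ∀ᵐ x ∂μ, ∀ᶠ t : ℕ in atTop, Real.exp (-ε * t) * g t x ≤ cylProb μ t x := by
  filter_upwards [ae_eventually_exp_mul_le_prob (P := μ) (measurable_firstLetters (n := n))
    (g := fun t u => g t (extend u)) (fun t u => hg t _) hg1 hε] with x hx
  filter_upwards [hx] with t ht
  rw [cylProb, cylinder_eq]
  rwa [hgd t fun i hi => extend_firstLetters x hi] at ht

/-- If almost every point starts with blocks that are more probable than `exp (-c l)` by arbitrarily
large factors, then the probabilities of initial words decay at a rate of at most `c`. -/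
theorem ae_eventually_exp_le_cylProb (hμ : Ergodic (shift (n := n)) μ) {c : ℝ} (hc : 0 ≤ c)
    (h : ∀ᵐ x ∂μ, ∀ K : ℕ, ∃ t : ℕ, Real.exp (K - c * t) < cylProb μ t x) {ε : ℝ} (hε : 0 < ε) :
    ∀ᵐ x ∂μ, ∀ᶠ t : ℕ in atTop, Real.exp (-((c + 4 * ε) * t)) ≤ cylProb μ t x := by
  set r := Real.exp (-ε) with hr
  have hr1 : r < 1 := by simpa [hr] using hε
  have hr0 : 0 < r := Real.exp_pos _
  set κ := (1 - r) / 2 with hκ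
  have hκ0 : 0 < κ := by rw [hκ]; linarith
  obtain ⟨K, hK⟩ := exists_nat_ge (1 / κ)
  have hKκ : 1 ≤ κ * Real.exp K := by
    have h1 := Real.add_one_le_exp (K : ℝ)
    have h2 : κ * (1 / κ) ≤ κ * Real.exp K := mul_le_mul_of_nonneg_left (by linarith) hκ0.le
    rwa [mul_one_div_cancel hκ0.ne'] at h2
  have hn : (1 : ℝ) ≤ n := by exact_mod_cast Nat.one_le_iff_ne_zero.2 (NeZero.ne n)
  set s := Real.log (2 * n) with hs
  have hs0 : 0 ≤ s := Real.log_nonneg (by linarith)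
  have hexps : Real.exp (-s) = 1 / (2 * n) := by
    rw [Real.exp_neg, hs, Real.exp_log (by linarith), one_div]
  -- Letters and blocks each receive half of the total weight. The factor `r ^ l` costs `ε` per unit
  -- length, and `exp K` compensates the constant `κ`.
  set b : ℕ → ℝ := fun l => κ * r ^ l with hb
  have hb0 : ∀ l, 0 ≤ b l := fun l => by positivity
  have hab : ∀ m, n * Real.exp (-s) + ∑ l ∈ Finset.range m, b (l + 1) ≤ 1 := by
    intro m
    have h1 : n * Real.exp (-s) = 1 / 2 := by
      rw [hexps]; field_simp
    have h2 : ∑ l ∈ Finset.range m, b (l + 1) ≤ κ * ∑ l ∈ Finset.range m, r ^ l := by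
      rw [Finset.mul_sum]
      refine Finset.sum_le_sum fun l _ => mul_le_mul_of_nonneg_left ?_ hκ0.le
      exact pow_le_pow_of_le_one hr0.le hr1.le (Nat.le_succ l)
    have h3 := mul_neg_geom_sum r m
    have h4 : 0 ≤ r ^ m := by positivity
    have h5 : κ * ∑ l ∈ Finset.range m, r ^ l = (1 - r ^ m) / 2 := by
      rw [← h3, hκ]; ring
    linarith
  -- Points without a favourable block of length at most `L`. By `h` their measure tends to zero, so
  -- for large `L` they occur with frequency below `η`.
  set D : ℕ → Set (ℕ → Fin n) := fun L => {x | ∀ l ≤ L, cylProb μ l x ≤ Real.exp (K - c * l)}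
    with hDdef
  have hDm : ∀ L, MeasurableSet (D L) := by
    intro L
    simp only [hDdef, Set.ofPred_forall]
    exact .iInter fun l => .iInter fun _ => measurableSet_le (measurable_cylProb l) measurable_const
  have hDanti : Antitone D := fun L L' hLL x hx l hl => hx l (hl.trans hLL)
  have hDlim : Tendsto (fun L => μ.real (D L)) atTop (𝓝 0) := by
    have h0 : μ (⋂ L, D L) = 0 := by
      refine measure_mono_null (fun x hx => ?_) (ae_iff.1 h)
      simp only [Set.mem_ofPred_eq, not_forall, not_exists, not_lt]
      exact ⟨K, fun t => Set.mem_iInter.1 hx t t le_rfl⟩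
    have h1 := tendsto_measure_iInter_atTop (μ := μ) (fun L => (hDm L).nullMeasurableSet) hDanti
      ⟨0, measure_ne_top _ _⟩
    rw [h0] at h1
    exact (ENNReal.tendsto_toReal_zero_iff fun L => measure_ne_top _ _).2 h1
  set η := ε / (s + 1) with hη
  have hη0 : 0 < η := by positivity
  have hsη : s * η ≤ ε := by
    rw [hη, ← mul_div_assoc, div_le_iff₀ (by linarith)]
    nlinarith
  obtain ⟨L, hL⟩ := (hDlim.eventually (gt_mem_nhds hη0)).exists
  have hD : ∀ x ∉ D L, ∃ l, 1 ≤ l ∧ l ≤ L ∧ Real.exp (-((c + ε) * l)) ≤ b l * cylProb μ l x := by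
    intro x hx
    simp only [hDdef, Set.mem_ofPred_eq, not_forall, not_le] at hx
    obtain ⟨l, hl, hlx⟩ := hx
    refine ⟨l, Nat.one_le_iff_ne_zero.2 ?_, hl, ?_⟩
    · rintro rfl
      have h1 := hlx.trans_le (cylProb_le_one 0 x)
      rw [Nat.cast_zero, mul_zero, sub_zero] at h1
      exact h1.not_ge (Real.one_le_exp K.cast_nonneg)
    · have h1 : r ^ l = Real.exp (-(ε * l)) := by
        rw [hr, ← Real.exp_nat_mul]; ring_nf
      have h2 : Real.exp (K - c * l) = Real.exp K * Real.exp (-(c * l)) := by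
        rw [← Real.exp_add, sub_eq_add_neg]
      calc Real.exp (-((c + ε) * l)) = 1 * (Real.exp (-(ε * l)) * Real.exp (-(c * l))) := by
            rw [← Real.exp_add, one_mul]; ring_nf
        _ ≤ (κ * Real.exp K) * (Real.exp (-(ε * l)) * Real.exp (-(c * l))) := by gcongr
        _ = b l * Real.exp (K - c * l) := by rw [hb, h2]; simp only [h1]; ring
        _ ≤ b l * cylProb μ l x := mul_le_mul_of_nonneg_left hlx.le (hb0 l)
  have hfm : Measurable fun x => (D L).indicator (1 : (ℕ → Fin n) → ℝ) x - η :=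
    (measurable_one.indicator (hDm L)).sub_const η
  have hind : Integrable ((D L).indicator (1 : (ℕ → Fin n) → ℝ)) μ :=
    (integrable_const 1).indicator (hDm L)
  have hbirk := ae_exists_birkhoffSum_le hμ hfm (hind.sub (integrable_const η)) (by
    rw [integral_sub hind (integrable_const η), integral_indicator_one (hDm L)]
    simpa using hL)
  filter_upwards [hbirk, ae_eventually_exp_mul_le_cylProb (μ := μ)
    (g := tileWeight (cylProb μ) (Real.exp (-s)) b)
    (tileWeight_nonneg cylProb_nonneg (Real.exp_nonneg _) hb0)
    (dependsOn_tileWeight dependsOn_cylProb)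
    (wordSum_tileWeight_le_one dependsOn_cylProb wordSum_cylProb (Real.exp_nonneg _) hb0 hab)
    hε] with x ⟨M, hM⟩ hx
  obtain ⟨N₀, hN₀⟩ := exists_nat_ge (s * (M + L) / ε)
  filter_upwards [hx, eventually_ge_atTop N₀] with N hN hNN
  have hcnt : birkhoffSum shift ((D L).indicator 1) N x ≤ η * N + M := by
    have h1 := hM N
    simp only [birkhoffSum, Finset.sum_sub_distrib, Finset.sum_const, Finset.card_range,
      nsmul_eq_mul] at h1 ⊢
    linarith
  have hlow := exp_le_tileWeight cylProb_nonneg hb0 hs0 (by linarith : 0 ≤ c + ε) hD N x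
  refine le_trans ?_ hN
  refine le_trans ?_ (mul_le_mul_of_nonneg_left hlow (Real.exp_nonneg _))
  rw [← Real.exp_add]
  -- The four `ε` come from Borel–Cantelli, the factors `r ^ l`, the letters at points of `D`, and
  -- the bounded term `s * (M + L)`.
  refine Real.exp_le_exp.2 ?_
  have h1 : s * (M + L) ≤ ε * N := by
    have h2 : s * (M + L) / ε ≤ N := hN₀.trans (Nat.cast_le.2 hNN)
    rwa [div_le_iff₀ hε, mul_comm (N : ℝ)] at h2
  have h2 := mul_le_mul_of_nonneg_left hcnt hs0
  have h3 : s * η * N ≤ ε * N := mul_le_mul_of_nonneg_right hsη N.cast_nonneg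
  linarith

theorem ae_eventually_exp_mul_log_card_le_cylProb {ε : ℝ} (hε : 0 < ε) :
    ∀ᵐ x ∂μ, ∀ᶠ t : ℕ in atTop, Real.exp (-((Real.log n + ε) * t)) ≤ cylProb μ t x := by
  have hn : (0 : ℝ) < n := by exact_mod_cast NeZero.pos n
  filter_upwards [ae_eventually_exp_mul_le_cylProb (μ := μ) (g := fun t _ => ((n : ℝ) ^ t)⁻¹)
    (fun t _ => by positivity) (fun t x y _ => rfl) (fun t => by simp [wordSum, hn.ne']) hε]
    with x hx
  filter_upwards [hx] with t ht
  refine le_trans (le_of_eq ?_) ht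
  rw [← Real.exp_log (pow_pos hn t), ← Real.exp_neg, ← Real.exp_add, Real.log_pow]
  ring_nf

/-- Dropping the first letter does not decrease the cylinder probability and changes the exponent by
`c` only, so the first alternative holds on a shift-subinvariant set, which is null or conull by
ergodicity. -/
theorem ae_or_ae_exists_cylProb_le (hμ : Ergodic (shift (n := n)) μ) (c : ℝ) :
    (∀ᵐ x ∂μ, ∀ K : ℕ, ∃ t : ℕ, Real.exp (K - c * t) < cylProb μ t x) ∨
      ∀ᵐ x ∂μ, ∃ K : ℕ, ∀ t : ℕ, cylProb μ t x ≤ Real.exp (K - c * t) := by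
  set F : Set (ℕ → Fin n) := {x | ∀ K : ℕ, ∃ t : ℕ, Real.exp (K - c * t) < cylProb μ t x} with hF
  have hFm : MeasurableSet F := by
    simp only [hF, Set.ofPred_forall, Set.ofPred_exists]
    exact .iInter fun K => .iUnion fun t => measurableSet_lt measurable_const (measurable_cylProb t)
  have hFT : F ⊆ shift ⁻¹' F := by
    intro x hx K
    obtain ⟨t, ht⟩ := hx (K + ⌈|c|⌉₊)
    have h1 := (le_abs_self c).trans (Nat.le_ceil |c|)
    push_cast at ht
    cases t with
    | zero =>
      exfalso
      refine (ht.trans_le (cylProb_le_one 0 x)).not_ge (Real.one_le_exp ?_)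
      simp only [Nat.cast_zero, mul_zero, sub_zero]
      positivity
    | succ t =>
      refine ⟨t, lt_of_le_of_lt (Real.exp_le_exp.2 ?_)
        (ht.trans_le (cylProb_succ_le_shift hμ.toMeasurePreserving t x))⟩
      push_cast
      linarith
  rcases hμ.ae_empty_or_univ_of_ae_le_preimage hFm.nullMeasurableSet (LE.le.eventuallyLE hFT)
    with h | h
  · right
    filter_upwards [eventuallyEq_empty.1 h] with x hx
    simpa [hF] using hx
  · left
    filter_upwards [eventuallyEq_univ.1 h] with x hx using hx

/-- The Shannon–McMillan–Breiman theorem on sequence space. -/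
theorem exists_ae_eventually_cylProb (hμ : Ergodic (shift (n := n)) μ) :
    ∃ q : ℝ, 0 ≤ q ∧ q ≤ Real.log n ∧ ∀ ε > 0, ∀ᵐ x ∂μ, ∀ᶠ t : ℕ in atTop,
      Real.exp (-((q + ε) * t)) ≤ cylProb μ t x ∧ cylProb μ t x ≤ Real.exp (-((q - ε) * t)) := by
  -- The rate is `sInf A`: just above it the tiling bound applies, and below it the zero-one
  -- alternative gives the upper bound.
  set A : Set ℝ :=
    {c | ∀ᵐ x ∂μ, ∀ K : ℕ, ∃ t : ℕ, Real.exp (K - c * t) < cylProb μ t x} with hA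
  have hpos : ∀ c ∈ A, 0 ≤ c := by
    intro c hc
    obtain ⟨x, hx⟩ := Eventually.exists (f := ae μ) hc
    obtain ⟨t, ht⟩ := hx 0
    by_contra hneg
    refine (ht.trans_le (cylProb_le_one t x)).not_ge (Real.one_le_exp ?_)
    have h1 : c * t ≤ 0 := mul_nonpos_of_nonpos_of_nonneg (not_le.1 hneg).le t.cast_nonneg
    simpa using h1
  have hup : ∀ c ∈ A, ∀ c', c ≤ c' → c' ∈ A := by
    intro c hc c' hcc
    filter_upwards [show ∀ᵐ x ∂μ, _ from hc] with x hx K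
    obtain ⟨t, ht⟩ := hx K
    refine ⟨t, lt_of_le_of_lt (Real.exp_le_exp.2 ?_) ht⟩
    have := mul_le_mul_of_nonneg_right hcc (Nat.cast_nonneg (α := ℝ) t)
    linarith
  have hlog : ∀ ε > 0, Real.log n + ε ∈ A := by
    intro ε hε
    filter_upwards [ae_eventually_exp_mul_log_card_le_cylProb (μ := μ) (half_pos hε)] with x hx K
    obtain ⟨N, hN⟩ := exists_nat_gt (K / (ε / 2))
    obtain ⟨t, ht, htN⟩ := (hx.and (eventually_ge_atTop N)).exists
    refine ⟨t, lt_of_lt_of_le (Real.exp_lt_exp.2 ?_) ht⟩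
    have h1 : (K : ℝ) / (ε / 2) < t := hN.trans_le (Nat.cast_le.2 htN)
    rw [div_lt_iff₀ (half_pos hε)] at h1
    linarith
  have hbdd : BddBelow A := ⟨0, hpos⟩
  have hne : A.Nonempty := ⟨_, hlog 1 one_pos⟩
  refine ⟨sInf A, le_csInf hne hpos,
    le_of_forall_pos_le_add fun ε hε => csInf_le hbdd (hlog ε hε), fun ε hε => ?_⟩
  have h1 : sInf A + ε / 8 ∈ A := by
    obtain ⟨c, hc, hlt⟩ := exists_lt_of_csInf_lt hne
      (show sInf A < sInf A + ε / 8 by linarith)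
    exact hup c hc _ hlt.le
  have h2 : sInf A - ε / 2 ∉ A := fun h => by linarith [csInf_le hbdd h]
  filter_upwards [ae_eventually_exp_le_cylProb hμ (hpos _ h1) h1 (show 0 < ε / 8 by linarith),
    (ae_or_ae_exists_cylProb_le hμ _).resolve_left h2] with x hx ⟨K, hK⟩
  obtain ⟨N, hN⟩ := exists_nat_ge (K / (ε / 2))
  filter_upwards [hx, eventually_ge_atTop N] with t ht htN
  have h3 : (K : ℝ) / (ε / 2) ≤ t := hN.trans (Nat.cast_le.2 htN)
  rw [div_le_iff₀ (half_pos hε)] at h3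
  have h4 : 0 ≤ ε * t := by positivity
  exact ⟨le_trans (Real.exp_le_exp.2 (by linarith)) ht,
    (hK t).trans (Real.exp_le_exp.2 (by linarith))⟩

variable {Ω : Type*} [MeasurableSpace Ω] {P : Measure Ω} [IsProbabilityMeasure P]
  {X : ℕ → Ω → Fin n}

/-- The Shannon–McMillan–Breiman theorem for stationary ergodic processes. -/
theorem IsStationaryErgodic.exists_ae_eventually_wordProb (hX : IsStationaryErgodic P X) :
    ∃ q : ℝ, 0 ≤ q ∧ q ≤ Real.log n ∧ ∀ ε > 0, ∀ᵐ ω ∂P, ∀ᶠ t : ℕ in atTop,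
      Real.exp (-((q + ε) * t)) ≤ wordProb P X (word X t ω) ∧
        wordProb P X (word X t ω) ≤ Real.exp (-((q - ε) * t)) := by
  have hm : Measurable (path X) := measurable_pi_lambda _ hX.measurable
  have := Measure.isProbabilityMeasure_map (μ := P) hm.aemeasurable
  obtain ⟨q, h0, h1, h⟩ := exists_ae_eventually_cylProb hX.ergodic
  refine ⟨q, h0, h1, fun ε hε => ?_⟩
  filter_upwards [ae_of_ae_map hm.aemeasurable (h ε hε)] with ω hω
  filter_upwards [hω] with t ht
  have heq : cylProb (P.map (path X)) t (path X ω) = wordProb P X (word X t ω) := by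
    rw [cylProb, cylinder_eq]
    exact map_measureReal_apply hm (measurable_firstLetters t (measurableSet_singleton _))
  rwa [heq] at ht

end AsymptoticEquipartition

/-! ### Identification of the almost sure rate with the limit entropy -/

section EntropyRate

variable {Ω : Type*} [MeasurableSpace Ω] {P : Measure Ω} [IsProbabilityMeasure P]

theorem integral_comp_eq_sum {V : Type*} [Fintype V] [MeasurableSpace V]
    [MeasurableSingletonClass V] {W : Ω → V} (hW : Measurable W) (g : V → ℝ) :
    ∫ ω, g (W ω) ∂P = ∑ v, P.real {ω | W ω = v} * g v := by
  have := Measure.isProbabilityMeasure_map (μ := P) hW.aemeasurable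
  rw [← integral_map hW.aemeasurable (measurable_of_finite g).aestronglyMeasurable,
    integral_fintype .of_finite]
  refine Finset.sum_congr rfl fun v _ => ?_
  rw [map_measureReal_apply hW (measurableSet_singleton v), smul_eq_mul]
  rfl

theorem measurable_word {n : ℕ} {X : ℕ → Ω → Fin n} (hX : ∀ i, Measurable (X i)) (t : ℕ) :
    Measurable (word X t) :=
  measurable_pi_lambda _ fun i => hX i

/-- A probability contributes little to the entropy beyond the level `M`. -/
theorem mul_sub_min_le {p t M : ℝ} (ht : 1 ≤ t) (hM : 0 ≤ M) (hp : 0 ≤ p) :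
    p * (-(1 / t) * Real.log p - min (-(1 / t) * Real.log p) M) ≤ 2 * Real.exp (-(t * M / 2)) := by
  have ht0 : 0 < t := by linarith
  rcases le_or_gt (-(1 / t) * Real.log p) M with h | h
  · rw [min_eq_left h, sub_self, mul_zero]
    positivity
  rcases hp.eq_or_lt with rfl | hp0
  · rw [zero_mul]
    positivity
  set v := -Real.log p with hv
  have hpv : p = Real.exp (-v) := by rw [hv, neg_neg, Real.exp_log hp0]
  have hs : -(1 / t) * Real.log p = v / t := by rw [hv]; ring
  rw [hs] at h ⊢
  rw [lt_div_iff₀ ht0] at h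
  have hv0 : 0 ≤ v := le_trans (by positivity) h.le
  have h1 : p * (v / t - min (v / t) M) ≤ p * v := by
    refine mul_le_mul_of_nonneg_left ?_ hp
    have h2 : 0 ≤ min (v / t) M := le_min (by positivity) hM
    linarith [div_le_self hv0 ht]
  have h3 : v ≤ 2 * Real.exp (v / 2) := by linarith [Real.add_one_le_exp (v / 2)]
  calc p * (v / t - min (v / t) M) ≤ p * v := h1
    _ ≤ Real.exp (-v) * (2 * Real.exp (v / 2)) := by
        rw [hpv]; exact mul_le_mul_of_nonneg_left h3 (Real.exp_nonneg _)
    _ = 2 * Real.exp (-(v / 2)) := by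
        rw [mul_left_comm, ← Real.exp_add]; ring_nf
    _ ≤ 2 * Real.exp (-(t * M / 2)) := by
        refine mul_le_mul_of_nonneg_left (Real.exp_le_exp.2 ?_) zero_le_two
        linarith

variable {n : ℕ} [NeZero n] {X : ℕ → Ω → Fin n}

/-- The sum is the expectation of the normalized information, which converges almost surely but is
not uniformly bounded. Dominated convergence applies after truncation at `M`, and `mul_sub_min_le`
controls the rest. -/
theorem tendsto_sum_mul_log_wordProb (hX : ∀ i, Measurable (X i)) {q : ℝ} (hq : 0 ≤ q)
    (hqn : q ≤ Real.log n) (h : ∀ ε > 0, ∀ᵐ ω ∂P, ∀ᶠ t : ℕ in atTop,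
      Real.exp (-((q + ε) * t)) ≤ wordProb P X (word X t ω) ∧
        wordProb P X (word X t ω) ≤ Real.exp (-((q - ε) * t))) :
    Tendsto (fun t : ℕ => ∑ u : Fin t → Fin n,
      wordProb P X u * (-(1 / (t : ℝ)) * Real.log (wordProb P X u))) atTop (𝓝 q) := by
  -- With this level, the `n ^ t` words lose at most `n ^ t * 2 exp (-t M / 2) = 2 exp (-t)` in
  -- total.
  set M := 2 * Real.log n + 2 with hM
  have hM0 : 0 ≤ M := by linarith
  set s : ∀ t : ℕ, (Fin t → Fin n) → ℝ := fun t u => -(1 / (t : ℝ)) * Real.log (wordProb P X u)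
    with hs
  have hp0 : ∀ {t : ℕ} (u : Fin t → Fin n), 0 ≤ wordProb P X u := fun u => measureReal_nonneg
  have hs0 : ∀ t u, 0 ≤ s t u := fun t u =>
    mul_nonneg_of_nonpos_of_nonpos (neg_nonpos.2 (by positivity))
      (Real.log_nonpos (hp0 u) measureReal_le_one)
  have hlim : ∀ᵐ ω ∂P, Tendsto (fun t => min (s t (word X t ω)) M) atTop (𝓝 q) := by
    filter_upwards [ae_all_iff.2 fun k : ℕ => h (1 / ((k : ℝ) + 1)) (by positivity)] with ω hω
    have hsl : Tendsto (fun t => s t (word X t ω)) atTop (𝓝 q) := by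
      rw [Metric.tendsto_atTop']
      intro ε hε
      obtain ⟨k, hk⟩ := exists_nat_one_div_lt hε
      obtain ⟨N, hN⟩ := eventually_atTop.1 (hω k)
      refine ⟨N, fun t ht => ?_⟩
      obtain ⟨h1, h2⟩ := hN t ht.le
      have ht0 : (0 : ℝ) < t := by exact_mod_cast (Nat.zero_le N).trans_lt ht
      have h3 := Real.log_le_log (Real.exp_pos _) h1
      have h4 := Real.log_le_log ((Real.exp_pos _).trans_le h1) h2
      rw [Real.log_exp] at h3 h4
      have h5 : s t (word X t ω) = -Real.log (wordProb P X (word X t ω)) / t := by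
        simp only [hs]; ring
      rw [Real.dist_eq, h5]
      refine lt_of_le_of_lt (abs_le.2 ⟨?_, ?_⟩) hk
      · rw [le_sub_iff_add_le, le_div_iff₀ ht0]
        linarith
      · rw [sub_le_iff_le_add, div_le_iff₀ ht0]
        linarith
    have := hsl.min (tendsto_const_nhds (x := M))
    rwa [min_eq_left (show q ≤ M by linarith)] at this
  have hint := tendsto_integral_of_dominated_convergence (μ := P) (fun _ => M)
    (F := fun t ω => min (s t (word X t ω)) M) (f := fun _ => q)
    (fun t => ((measurable_of_finite fun u => min (s t u) M).comp
      (measurable_word hX t)).aestronglyMeasurable)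
    (integrable_const M)
    (fun t => .of_forall fun ω => by
      rw [Real.norm_of_nonneg (le_min (hs0 _ _) hM0)]; exact min_le_right _ _) hlim
  simp only [integral_const, probReal_univ, one_smul] at hint
  have hexp : Tendsto (fun t : ℕ => 2 * Real.exp (-1) ^ t) atTop (𝓝 0) := by
    have := (tendsto_pow_atTop_nhds_zero_of_lt_one (Real.exp_nonneg (-1)) (by simp)).const_mul 2
    rwa [mul_zero] at this
  have hsum := hint.add hexp
  rw [add_zero] at hsum
  refine tendsto_of_tendsto_of_tendsto_of_le_of_le' hint hsum (.of_forall fun t => ?_) ?_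
  · rw [integral_comp_eq_sum (measurable_word hX t) fun u => min (s t u) M]
    exact Finset.sum_le_sum fun u _ => mul_le_mul_of_nonneg_left (min_le_left _ _) (hp0 u)
  · filter_upwards [eventually_ge_atTop 1] with t ht
    rw [integral_comp_eq_sum (measurable_word hX t) fun u => min (s t u) M,
      ← sub_le_iff_le_add', ← Finset.sum_sub_distrib]
    have hn : (0 : ℝ) < n := by exact_mod_cast NeZero.pos n
    calc _ ≤ ∑ u : Fin t → Fin n, 2 * Real.exp (-(t * M / 2)) := by
          refine Finset.sum_le_sum fun u _ => ?_
          rw [show P.real {ω | word X t ω = u} = wordProb P X u from rfl, ← mul_sub]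
          exact mul_sub_min_le (by exact_mod_cast ht) hM0 (hp0 u)
      _ = 2 * Real.exp (-1) ^ t := by
          rw [Finset.sum_const, Finset.card_univ, Fintype.card_fun, Fintype.card_fin,
            Fintype.card_fin, nsmul_eq_mul, mul_left_comm]
          congr 1
          rw [← Real.exp_nat_mul, Nat.cast_pow, ← Real.exp_log (pow_pos hn t), ← Real.exp_add,
            Real.log_pow, hM]
          ring_nf

theorem IsStationaryErgodic.exists_tendsto_orderEntropy (hX : IsStationaryErgodic P X) :
    ∃ h : ℝ, Tendsto (orderEntropy P X) atTop (𝓝 h) ∧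
      ∀ ε > 0, ∀ᵐ ω ∂P, ∀ᶠ t : ℕ in atTop,
        Real.exp (-((h * Real.log 2 + ε) * t)) ≤ wordProb P X (word X t ω) ∧
          wordProb P X (word X t ω) ≤ Real.exp (-((h * Real.log 2 - ε) * t)) := by
  obtain ⟨q, h0, hn, h⟩ := hX.exists_ae_eventually_wordProb
  have hlog : Real.log 2 ≠ 0 := (Real.log_pos one_lt_two).ne'
  refine ⟨q / Real.log 2, ?_, by rwa [div_mul_cancel₀ q hlog]⟩
  -- Order `m` means words of length `m + 1`; dividing by `log 2` turns nats into bits.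
  have hlim := ((tendsto_sum_mul_log_wordProb hX.measurable h0 hn h).comp
    (tendsto_add_atTop_nat 1)).div_const (Real.log 2)
  refine hlim.congr fun m => ?_
  simp only [Function.comp_apply, orderEntropy, Finset.sum_div, Finset.mul_sum, Real.logb]
  refine Finset.sum_congr rfl fun u _ => ?_
  push_cast
  ring

theorem IsStationaryErgodic.tendsto_orderEntropy (hX : IsStationaryErgodic P X) :
    Tendsto (orderEntropy P X) atTop (𝓝 (entropy P X)) := by
  obtain ⟨h, hh, -⟩ := hX.exists_tendsto_orderEntropy
  exact tendsto_nhds_limUnder ⟨h, hh⟩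

theorem IsStationaryErgodic.ae_eventually_wordProb (hX : IsStationaryErgodic P X) {ε : ℝ}
    (hε : 0 < ε) :
    ∀ᵐ ω ∂P, ∀ᶠ t : ℕ in atTop,
      Real.exp (-((entropy P X * Real.log 2 + ε) * t)) ≤ wordProb P X (word X t ω) ∧
        wordProb P X (word X t ω) ≤ Real.exp (-((entropy P X * Real.log 2 - ε) * t)) := by
  obtain ⟨h, hh, hae⟩ := hX.exists_tendsto_orderEntropy
  rw [entropy, hh.limUnder_eq]
  exact hae ε hε

end EntropyRate

/-! ### Typical decipherings and the exponent -/

section Ciphertext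

theorem word_ciphertext {Ω : Type*} {n : ℕ} (X Y : ℕ → Ω → Fin n) (t : ℕ) (ω : Ω) :
    word (ciphertext X Y) t ω = word X t ω + word Y t ω := rfl

variable {Ω : Type*} [MeasurableSpace Ω] {P : Measure Ω} {n : ℕ} {X Y : ℕ → Ω → Fin n}

/-- The joint probability of the plaintext `x` and the ciphertext `z`. -/
noncomputable def jointProb (P : Measure Ω) (X Y : ℕ → Ω → Fin n) {t : ℕ} (z x : Fin t → Fin n) :
    ℝ :=
  wordProb P X x * wordProb P Y (z - x)

theorem measurable_ciphertext (hX : ∀ i, Measurable (X i)) (hY : ∀ i, Measurable (Y i)) (i : ℕ) :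
    Measurable (ciphertext X Y i) :=
  (measurable_of_finite fun p : Fin n × Fin n => p.1 + p.2).comp ((hX i).prodMk (hY i))

open Classical in
/-- The plaintexts whose joint probability with the ciphertext `z` is `exp (-t H)` up to a factor
between `exp (-t ε)` and `exp (t ε)`. -/
noncomputable def typicalSet (P : Measure Ω) (X Y : ℕ → Ω → Fin n) (H ε : ℝ) :
    DecipheringSets n := fun t z =>
  {x | 0 < jointProb P X Y z x ∧ |Real.log (jointProb P X Y z x) + t * H| < t * ε}

theorem mem_typicalSet {H ε : ℝ} {t : ℕ} {z x : Fin t → Fin n} :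
    x ∈ typicalSet P X Y H ε t z ↔
      0 < jointProb P X Y z x ∧ |Real.log (jointProb P X Y z x) + t * H| < t * ε := by
  simp [typicalSet]

theorem condProb_eq_inv_mul {Z : ℕ → Ω → Fin n} (hZ : ∀ i, Measurable (Z i)) {t : ℕ}
    (z : Fin t → Fin n) (S : Finset (Fin t → Fin n)) :
    condProb P X Z z S =
      (P.real {ω | word Z t ω = z})⁻¹ * P.real ({ω | word Z t ω = z} ∩ {ω | word X t ω ∈ S}) := by
  have hm : MeasurableSet {ω | word Z t ω = z} :=
    measurable_word hZ t (measurableSet_singleton z)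
  rw [condProb, measureReal_def, ProbabilityTheory.cond_apply hm, ENNReal.toReal_mul,
    ENNReal.toReal_inv]
  rfl

theorem condProb_le_one [IsFiniteMeasure P] {Z : ℕ → Ω → Fin n} (hZ : ∀ i, Measurable (Z i)) {t : ℕ}
    (z : Fin t → Fin n) (S : Finset (Fin t → Fin n)) : condProb P X Z z S ≤ 1 := by
  rw [condProb_eq_inv_mul hZ, inv_mul_eq_div]
  exact div_le_one_of_le₀ (measureReal_mono Set.inter_subset_left) measureReal_nonneg

variable [NeZero n]

theorem measureReal_ciphertext_inter
    (hXY : ProbabilityTheory.IndepFun (path X) (path Y) P) {t : ℕ} (z x : Fin t → Fin n) :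
    P.real ({ω | word (ciphertext X Y) t ω = z} ∩ {ω | word X t ω = x}) = jointProb P X Y z x := by
  have hset : {ω | word (ciphertext X Y) t ω = z} ∩ {ω | word X t ω = x} =
      word X t ⁻¹' {x} ∩ word Y t ⁻¹' {z - x} := by
    ext ω
    simp only [Set.mem_inter_iff, Set.mem_ofPred_eq, Set.mem_preimage, Set.mem_singleton_iff,
      word_ciphertext]
    constructor
    · rintro ⟨rfl, rfl⟩
      exact ⟨rfl, (add_sub_cancel_left _ _).symm⟩
    · rintro ⟨rfl, h⟩
      exact ⟨by rw [h, add_sub_cancel], rfl⟩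
  have hind : ProbabilityTheory.IndepFun (word X t) (word Y t) P :=
    hXY.comp (measurable_firstLetters t) (measurable_firstLetters t)
  rw [hset, measureReal_def, hind.measure_inter_preimage_eq_mul _ _ (measurableSet_singleton _)
    (measurableSet_singleton _), ENNReal.toReal_mul]
  rfl

variable [IsProbabilityMeasure P]

theorem condProb_ciphertext (hX : ∀ i, Measurable (X i)) (hY : ∀ i, Measurable (Y i))
    (hXY : ProbabilityTheory.IndepFun (path X) (path Y) P) {t : ℕ} (z : Fin t → Fin n)
    (S : Finset (Fin t → Fin n)) :
    condProb P X (ciphertext X Y) z S =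
      (P.real {ω | word (ciphertext X Y) t ω = z})⁻¹ * ∑ x ∈ S, jointProb P X Y z x := by
  classical
  rw [condProb_eq_inv_mul (measurable_ciphertext hX hY)]
  congr 1
  rw [measureReal_eq_sum_fiber (measurable_word hX t), ← Finset.sum_subset S.subset_univ (f := fun x =>
    P.real ({ω | word (ciphertext X Y) t ω = z} ∩ {ω | word X t ω ∈ S} ∩ {ω | word X t ω = x}))
    fun x _ hx => ?_]
  · refine Finset.sum_congr rfl fun x hx => ?_
    rw [← measureReal_ciphertext_inter hXY]
    congr 1
    ext ω
    simp only [Set.mem_inter_iff, Set.mem_ofPred_eq]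
    exact ⟨fun h => ⟨h.1.1, h.2⟩, fun h => ⟨⟨h.1, h.2 ▸ hx⟩, h.2⟩⟩
  · rw [show {ω | word (ciphertext X Y) t ω = z} ∩ {ω | word X t ω ∈ S} ∩ {ω | word X t ω = x} = ∅
      from Set.eq_empty_of_forall_notMem fun ω h => hx (h.2 ▸ h.1.2), measureReal_empty]

/-- The entropy, in nats per letter, of the pair of two independent processes. -/
noncomputable def pairEntropy (P : Measure Ω) (X Y : ℕ → Ω → Fin n) : ℝ :=
  (entropy P X + entropy P Y) * Real.log 2

theorem ae_eventually_mem_typicalSet (hX : IsStationaryErgodic P X) (hY : IsStationaryErgodic P Y)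
    {ε : ℝ} (hε : 0 < ε) :
    ∀ᵐ ω ∂P, ∀ᶠ t : ℕ in atTop,
      word X t ω ∈ typicalSet P X Y (pairEntropy P X Y) ε t (word (ciphertext X Y) t ω) := by
  have hε3 : 0 < ε / 3 := by linarith
  filter_upwards [hX.ae_eventually_wordProb hε3, hY.ae_eventually_wordProb hε3] with ω hx hy
  filter_upwards [hx, hy, eventually_ge_atTop 1] with t ⟨hx1, hx2⟩ ⟨hy1, hy2⟩ ht
  have hxpos := (Real.exp_pos _).trans_le hx1
  have hypos := (Real.exp_pos _).trans_le hy1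
  have hεt : 0 < ε * t := mul_pos hε (by exact_mod_cast ht)
  rw [mem_typicalSet, jointProb, word_ciphertext, add_sub_cancel_left]
  refine ⟨mul_pos hxpos hypos, ?_⟩
  rw [Real.log_mul hxpos.ne' hypos.ne', abs_lt, pairEntropy]
  have h1 := Real.log_le_log (Real.exp_pos _) hx1
  have h2 := Real.log_le_log hxpos hx2
  have h3 := Real.log_le_log (Real.exp_pos _) hy1
  have h4 := Real.log_le_log hypos hy2
  rw [Real.log_exp] at h1 h2 h3 h4
  constructor <;> linarith

/-- Comparison with the uniform law on words. It asks for no ergodicity of the ciphertext, which can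
fail for a sum of independent ergodic processes. -/
theorem ae_eventually_exp_le_prob_word {Z : ℕ → Ω → Fin n} (hZ : ∀ i, Measurable (Z i)) {ε : ℝ}
    (hε : 0 < ε) :
    ∀ᵐ ω ∂P, ∀ᶠ t : ℕ in atTop,
      Real.exp (-((Real.log n + ε) * t)) ≤ P.real {ω' | word Z t ω' = word Z t ω} := by
  have hn : (0 : ℝ) < n := by exact_mod_cast NeZero.pos n
  filter_upwards [ae_eventually_exp_mul_le_prob (P := P) (measurable_word hZ)
    (g := fun t _ => ((n : ℝ) ^ t)⁻¹) (fun t _ => by positivity) (fun t => by simp [hn.ne']) hε]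
    with ω hω
  filter_upwards [hω] with t ht
  refine le_trans (le_of_eq ?_) ht
  rw [← Real.exp_log (pow_pos hn t), ← Real.exp_neg, ← Real.exp_add, Real.log_pow]
  ring_nf

theorem hasHighProbability_typicalSet (hX : IsStationaryErgodic P X)
    (hY : IsStationaryErgodic P Y) {ε δ : ℝ} (hε : 0 < ε) (hδ : 0 < δ) :
    HasHighProbability P X (ciphertext X Y) δ (typicalSet P X Y (pairEntropy P X Y) ε) := by
  have hZ := measurable_ciphertext hX.measurable hY.measurable
  set T := typicalSet P X Y (pairEntropy P X Y) ε with hT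
  set Z := ciphertext X Y with hZdef
  have hGm : ∀ t, MeasurableSet {ω | word X t ω ∈ T t (word Z t ω)} := fun t =>
    (measurable_word hX.measurable t).prodMk (measurable_word hZ t)
      (Set.toFinite {p : (Fin t → Fin n) × (Fin t → Fin n) | p.1 ∈ T t p.2}).measurableSet
  filter_upwards [ae_eventually_condProb_compl_le (P := P) (measurable_word hZ)
    (fun s t ω ω' hst h => funext fun i => congrFun h (Fin.castLE hst i)) hGm
    (ae_eventually_mem_typicalSet hX hY hε) (half_pos hδ),
    ae_eventually_exp_le_prob_word hZ one_pos] with ω h1 h2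
  filter_upwards [h1, h2] with t h1 h2
  have hpos := (Real.exp_pos _).trans_le h2
  rw [condProb_eq_inv_mul hZ, inv_mul_eq_div, lt_div_iff₀ hpos]
  have hsplit := measureReal_inter_add_sdiff (μ := P) (hGm t) (s := {ω' | word Z t ω' = word Z t ω})
  -- On the fibre the ciphertext is constant, so the varying typical set may be replaced by the one
  -- at `ω`.
  have e1 : {ω' | word Z t ω' = word Z t ω} ∩ {ω | word X t ω ∈ T t (word Z t ω)} =
      {ω' | word Z t ω' = word Z t ω} ∩ {ω' | word X t ω' ∈ T t (word Z t ω)} := by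
    ext ω'
    simp only [Set.mem_inter_iff, Set.mem_ofPred_eq]
    exact and_congr_right fun h => by rw [h]
  rw [Set.sdiff_eq, Set.inter_comm _ {ω | word X t ω ∈ T t (word Z t ω)}ᶜ, e1] at hsplit
  have := mul_pos hδ hpos
  linarith

/-- Two logarithms within `t ε log 2 / 2` nats of `-t H` differ by less than `t ε` bits; the
probability of the ciphertext cancels. -/
theorem isNearlyEquiprobable_typicalSet (hX : IsStationaryErgodic P X)
    (hY : IsStationaryErgodic P Y) (hXY : ProbabilityTheory.IndepFun (path X) (path Y) P)
    (H : ℝ) {ε : ℝ} :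
    IsNearlyEquiprobable P X (ciphertext X Y) ε
      (typicalSet P X Y H (ε * Real.log 2 / 2)) := by
  have hlog : 0 < Real.log 2 := Real.log_pos one_lt_two
  refine .of_forall fun ω => ?_
  filter_upwards [eventually_ge_atTop 1] with t ht
  have ht0 : (0 : ℝ) < t := by exact_mod_cast ht
  set z := word (ciphertext X Y) t ω
  have hpos : ∀ x, 0 < jointProb P X Y z x →
      0 < P.real {ω | word (ciphertext X Y) t ω = z} := by
    intro x hx
    rw [← measureReal_ciphertext_inter hXY] at hx
    exact hx.trans_le (measureReal_mono Set.inter_subset_left)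
  have hcond : ∀ x, condProb P X (ciphertext X Y) z {x} =
      (P.real {ω | word (ciphertext X Y) t ω = z})⁻¹ * jointProb P X Y z x := by
    intro x
    rw [condProb_ciphertext hX.measurable hY.measurable hXY, Finset.sum_singleton]
  refine ⟨fun x hx => ?_, fun x₁ h₁ x₂ h₂ => ?_⟩
  · have hx0 := (mem_typicalSet.1 hx).1
    rw [hcond]
    exact mul_pos (inv_pos.2 (hpos x hx0)) hx0
  · obtain ⟨h₁p, h₁⟩ := mem_typicalSet.1 h₁
    obtain ⟨h₂p, h₂⟩ := mem_typicalSet.1 h₂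
    have hZ := inv_ne_zero (hpos x₁ h₁p).ne'
    rw [hcond, hcond, Real.logb_mul hZ h₁p.ne', Real.logb_mul hZ h₂p.ne',
      add_sub_add_left_eq_sub, Real.logb, Real.logb, ← sub_div, abs_div, abs_of_pos hlog,
      one_div_mul_eq_div, div_div, div_lt_iff₀ (by positivity)]
    rw [abs_lt] at h₁ h₂ ⊢
    constructor <;> linarith [h₁.1, h₁.2, h₂.1, h₂.2]

/-- A set of decipherings whose conditional probability exceeds `1 - δ` is large as soon as the
typical plaintexts have high conditional probability. -/
theorem mul_exp_le_card (hX : IsStationaryErgodic P X) (hY : IsStationaryErgodic P Y)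
    (hXY : ProbabilityTheory.IndepFun (path X) (path Y) P) {H ε δ r : ℝ} {t : ℕ}
    {z : Fin t → Fin n} {S : Finset (Fin t → Fin n)}
    (hS : 1 - δ < condProb P X (ciphertext X Y) z S)
    (hT : 1 - (1 - δ) / 2 < condProb P X (ciphertext X Y) z (typicalSet P X Y H ε t z))
    (hz : Real.exp (-(r * t)) ≤ P.real {ω | word (ciphertext X Y) t ω = z}) (hδ : δ < 1) :
    (1 - δ) / 2 * Real.exp ((H - ε - r) * t) ≤ S.card := by
  classical
  set T := typicalSet P X Y H ε t z with hTdef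
  set c := P.real {ω | word (ciphertext X Y) t ω = z} with hc
  have hcpos : 0 < c := (Real.exp_pos _).trans_le hz
  have hle := condProb_le_one (P := P) (X := X)
    (measurable_ciphertext hX.measurable hY.measurable) z (T ∪ S)
  rw [condProb_ciphertext hX.measurable hY.measurable hXY, inv_mul_eq_div] at hS hT hle
  rw [lt_div_iff₀ hcpos] at hS hT
  rw [div_le_iff₀ hcpos] at hle
  -- By inclusion–exclusion, `T ∩ S` carries joint probability at least `(1 - δ) / 2 * c`.
  have hui := Finset.sum_union_inter (s₁ := T) (s₂ := S) (f := jointProb P X Y z)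
  have hinter : ∑ x ∈ T ∩ S, jointProb P X Y z x ≤ S.card * Real.exp (-((H - ε) * t)) := by
    calc _ ≤ ∑ x ∈ T ∩ S, Real.exp (-((H - ε) * t)) := by
          refine Finset.sum_le_sum fun x hx => ?_
          obtain ⟨h1, h2⟩ := mem_typicalSet.1 (Finset.mem_inter.1 hx).1
          rw [← Real.log_le_iff_le_exp h1]
          linarith [(abs_lt.1 h2).2]
      _ = (T ∩ S).card * Real.exp (-((H - ε) * t)) := by rw [Finset.sum_const, nsmul_eq_mul]
      _ ≤ _ := by
          gcongr
          exact Finset.inter_subset_right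
  have hmain : (1 - δ) / 2 * Real.exp (-(r * t)) ≤ S.card * Real.exp (-((H - ε) * t)) := by
    have := mul_le_mul_of_nonneg_left hz (show 0 ≤ (1 - δ) / 2 by linarith)
    linarith
  have h3 := mul_le_mul_of_nonneg_right hmain (Real.exp_nonneg ((H - ε) * t))
  rw [mul_assoc, mul_assoc, ← Real.exp_add, ← Real.exp_add, neg_add_cancel, Real.exp_zero,
    mul_one] at h3
  rwa [show (H - ε - r) * t = -(r * t) + (H - ε) * t by ring]

theorem growthExponentAtLeast_of_hasHighProbability (hX : IsStationaryErgodic P X)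
    (hY : IsStationaryErgodic P Y) (hXY : ProbabilityTheory.IndepFun (path X) (path Y) P)
    {δ : ℝ} (hδ : δ < 1) {Ψ : DecipheringSets n}
    (hΨ : HasHighProbability P X (ciphertext X Y) δ Ψ) :
    GrowthExponentAtLeast P (ciphertext X Y)
      (entropy P X + entropy P Y - Real.logb 2 n) Ψ := by
  have hlog : 0 < Real.log 2 := Real.log_pos one_lt_two
  have hZ := measurable_ciphertext hX.measurable hY.measurable
  set r := entropy P X + entropy P Y - Real.logb 2 n with hr
  have hrlog : r * Real.log 2 = pairEntropy P X Y - Real.log n := by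
    rw [hr, pairEntropy, sub_mul, Real.logb, div_mul_cancel₀ _ hlog.ne']
  have hδ' : 0 < (1 - δ) / 2 := by linarith
  -- Countably many error levels suffice. The three errors, converted to bits, stem from the typical
  -- set, the ciphertext probability and the constant `(1 - δ) / 2`.
  have key : ∀ k : ℕ, ∀ᵐ ω ∂P, ((r - 3 / Real.log 2 * (1 / ((k : ℝ) + 1)) : ℝ) : EReal) ≤
      liminf (fun t : ℕ => logRate t (Ψ t (word (ciphertext X Y) t ω)).card) atTop := by
    intro k
    set ε := 1 / ((k : ℝ) + 1) with hε
    have hε0 : 0 < ε := by positivity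
    filter_upwards [hΨ, hasHighProbability_typicalSet hX hY hε0 hδ',
      ae_eventually_exp_le_prob_word hZ hε0] with ω h1 h2 h3
    refine le_liminf_of_le (by isBoundedDefault) ?_
    obtain ⟨N, hN⟩ := exists_nat_ge (-Real.log ((1 - δ) / 2) / ε)
    filter_upwards [h1, h2, h3, eventually_ge_atTop N, eventually_ge_atTop 1]
      with t h1 h2 h3 htN ht
    have hcard := mul_exp_le_card hX hY hXY h1 h2 h3 hδ
    have hpos := mul_pos hδ' (Real.exp_pos ((pairEntropy P X Y - ε - (Real.log n + ε)) * t))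
    have ht0 : (0 : ℝ) < t := by exact_mod_cast ht
    have hne : (Ψ t (word (ciphertext X Y) t ω)).card ≠ 0 := by
      exact_mod_cast (hpos.trans_le hcard).ne'
    rw [logRate, if_neg hne]
    refine EReal.coe_le_coe_iff.2 ?_
    have hl := Real.log_le_log hpos hcard
    rw [Real.log_mul hδ'.ne' (Real.exp_pos _).ne', Real.log_exp] at hl
    have hN' : -Real.log ((1 - δ) / 2) / ε ≤ t := hN.trans (Nat.cast_le.2 htN)
    rw [div_le_iff₀ hε0] at hN'
    rw [Real.logb, one_div_mul_eq_div, div_div, le_div_iff₀ (by positivity)]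
    have hlhs : (r - 3 / Real.log 2 * ε) * (Real.log 2 * t) =
        (r * Real.log 2 - 3 * ε) * t := by
      field_simp
    rw [hlhs, hrlog]
    linarith
  filter_upwards [ae_all_iff.2 key] with ω hω
  have hlim : Tendsto (fun k : ℕ => ((r - 3 / Real.log 2 * (1 / ((k : ℝ) + 1)) : ℝ) : EReal))
      atTop (𝓝 (r : EReal)) := by
    refine (continuous_coe_real_ereal.tendsto r).comp ?_
    have := (tendsto_one_div_add_atTop_nhds_zero_nat (𝕜 := ℝ)).const_mul (3 / Real.log 2)
    simpa using this.const_sub r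
  exact le_of_tendsto' hlim hω

end Ciphertext

end RunningKey

theorem corollary1 {Ω : Type*} [MeasurableSpace Ω] (P : Measure Ω) [IsProbabilityMeasure P]
    (n : ℕ) (hn : 2 ≤ n) (X Y : ℕ → Ω → Fin n)
    (hX : RunningKey.IsStationaryErgodic P X) (hY : RunningKey.IsStationaryErgodic P Y)
    (hXY : ProbabilityTheory.IndepFun (RunningKey.path X) (RunningKey.path Y) P) :
    -- the limits that define `h(X)` and `h(Y)` exist
    Tendsto (RunningKey.orderEntropy P X) atTop (𝓝 (RunningKey.entropy P X)) ∧
    Tendsto (RunningKey.orderEntropy P Y) atTop (𝓝 (RunningKey.entropy P Y)) ∧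
    -- sets of nearly equiprobable decipherings of total probability close to one exist
    -- and have at least the claimed exponent
    (∀ ε : ℝ, 0 < ε → ∀ δ : ℝ, 0 < δ → ∃ Ψ : RunningKey.DecipheringSets n,
      RunningKey.HasHighProbability P X (RunningKey.ciphertext X Y) δ Ψ ∧
      RunningKey.IsNearlyEquiprobable P X (RunningKey.ciphertext X Y) ε Ψ ∧
      RunningKey.GrowthExponentAtLeast P (RunningKey.ciphertext X Y)
        (RunningKey.entropy P X + RunningKey.entropy P Y - Real.logb 2 n) Ψ) ∧
    -- every choice of sets of total probability close to one has at least that exponent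
    (∀ δ : ℝ, 0 < δ → δ < 1 → ∀ Ψ : RunningKey.DecipheringSets n,
      RunningKey.HasHighProbability P X (RunningKey.ciphertext X Y) δ Ψ →
      RunningKey.GrowthExponentAtLeast P (RunningKey.ciphertext X Y)
        (RunningKey.entropy P X + RunningKey.entropy P Y - Real.logb 2 n) Ψ) ∧
    -- the same exponent in terms of the redundancy of the key
    RunningKey.entropy P X + RunningKey.entropy P Y - Real.logb 2 n =
      RunningKey.entropy P X - RunningKey.redundancy P Y := by
  have : NeZero n := ⟨by omega⟩
  refine ⟨hX.tendsto_orderEntropy, hY.tendsto_orderEntropy, fun ε hε δ hδ => ?_,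
    fun δ _ hδ1 Ψ hΨ =>
      RunningKey.growthExponentAtLeast_of_hasHighProbability hX hY hXY hδ1 hΨ, ?_⟩
  · have hε' : 0 < ε * Real.log 2 / 2 := by
      have := Real.log_pos one_lt_two
      positivity
    exact ⟨RunningKey.typicalSet P X Y (RunningKey.pairEntropy P X Y) (ε * Real.log 2 / 2),
      RunningKey.hasHighProbability_typicalSet hX hY hε' hδ,
      RunningKey.isNearlyEquiprobable_typicalSet hX hY hXY _,
      -- The given `δ` may be at least one, but the same sets have high probability at level `1 / 2`
      -- too.
      RunningKey.growthExponentAtLeast_of_hasHighProbability hX hY hXY one_half_lt_one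
        (RunningKey.hasHighProbability_typicalSet hX hY hε' one_half_pos)⟩
  · rw [RunningKey.redundancy]
    ring
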